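/- Let $\mathbf{k}$ be an algebraically closed field of characteristic zero and let $\mathcal{C}$ be a modular tensor category over $\mathbf{k}$, that is: a fusion category over $\mathbf{k}$ (a $\mathbf{k}$-linear abelian semisimple rigid tensor category with finitely many simple objects up to isomorphism, finite-dimensional morphism spaces and $\operatorname{End}(\mathbf{1})=\mathbf{k}$) with a braiding $\sigma$ and a ribbon structure $\theta$ (a natural automorphism of $\mathrm{Id}_{\mathcal C}$ with $\theta_{X\otimes Y}=(\theta_X\otimes\theta_Y)\circ\sigma_{Y,X}\circ\sigma_{X,Y}$ and $(\theta_X)^*=\theta_{X^*}$), whose $S$-matrix is non-degenerate. Here the $S$-matrix is $S=(s_{X,Y})_{X,Y\in\mathcal{O}(\mathcal{C})}$ with $s_{X,Y}=\operatorname{Tr}(\sigma_{Y,X}\sigma_{X,Y})$, where $\mathcal{O}(\mathcal{C})$ is the set of isomorphism classes of simple objects and $\operatorname{Tr}$ is the trace of the spherical structure determined by $\theta$. Let $\mathcal{G}(\mathcal{C})$ be the group of isomorphism classes of invertible objects, acting on $\mathcal{O}(\mathcal{C})$ by tensor product from the left, and for $X\in\mathcal{O}(\mathcal{C})$ let $G[X]=\{g\in\mathcal{G}(\mathcal{C})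 : g\otimes X\cong X\}$. 1. For every $X\in\mathcal{O}(\mathcal{C})$ such that $G[X]$ is non-trivial, there exists $Y\in\mathcal{O}(\mathcal{C})$ such that $s_{X,Y}=0$. 2. Consequently, if the $S$-matrix of $\mathcal{C}$ has no zero entries, then $\mathcal{G}(\mathcal{C})$ acts freely on $\mathcal{O}(\mathcal{C})$. -/

import Mathlib

open CategoryTheory MonoidalCategory Limits

universe w v u

noncomputable section

namespace ModularTensor

attribute [local instance] Abelian.hasFiniteBiproducts

/-! ### Fusion categories -/

section IsoClasses

variable (C : Type u) [Category.{v} C]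

/-- The set `O(C)` of isomorphism classes of simple objects of `C`
(`Skeleton C` is the set of isomorphism classes of objects of `C`, and `X.out` is a representative
of the class `X`). -/
def SimpleClass [HasZeroMorphisms C] : Type u := {X : Skeleton C // Simple X.out}

variable {C} in
/-- A representative of an isomorphism class of simple objects. -/
def SimpleClass.obj [HasZeroMorphisms C] (X : SimpleClass C) : C := X.1.out

/-- The group `G(C)` of isomorphism classes of invertible objects of `C`: the units of the monoid of
isomorphism classes of objects under the tensor product. -/
abbrev InvertibleClass [MonoidalCategory C] : Type u := (Skeleton C)ˣ

end IsoClasses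

/-- A fusion category over `k`: a `k`-linear semisimple rigid tensor category, with finitely many
isomorphism classes of simple objects, finite dimensional spaces of morphisms, and such that the
endomorphism algebra of the unit object is `k`. -/
class IsFusion (k : Type w) [Field k] (C : Type u) [Category.{v} C] [Abelian C] [Linear k C]
    [MonoidalCategory C] [MonoidalPreadditive C] [MonoidalLinear k C] [RigidCategory C] :
    Prop where
  semisimple : ∀ X : C, ∃ (n : ℕ) (F : Fin n → C), (∀ i, Simple (F i)) ∧ Nonempty (X ≅ ⨁ F)
  finite_simples : Finite (SimpleClass C)
  finite_hom : ∀ X Y : C, FiniteDimensional k (X ⟶ Y)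
  end_unit : Function.Bijective (algebraMap k (End (𝟙_ C)))

/-! ### The action of invertible objects on simple objects -/

section Action

variable {C : Type u} [Category.{v} C] [MonoidalCategory C]

theorem isEquivalence_tensorLeft {g h : C} (e : g ⊗ h ≅ 𝟙_ C) (e' : h ⊗ g ≅ 𝟙_ C) :
    (tensorLeft g).IsEquivalence := by
  have hη : tensorLeft g ⋙ tensorLeft h ≅ 𝟭 C :=
    (tensorLeftTensor h g).symm ≪≫ (tensoringLeft C).mapIso e' ≪≫ leftUnitorNatIso C
  have hε : tensorLeft h ⋙ tensorLeft g ≅ 𝟭 C :=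
    (tensorLeftTensor g h).symm ≪≫ (tensoringLeft C).mapIso e ≪≫ leftUnitorNatIso C
  exact (CategoryTheory.Equivalence.mk _ _ hη.symm hε).isEquivalence_functor

theorem simple_units_mul [HasZeroMorphisms C] (g : (Skeleton C)ˣ) (X : Skeleton C)
    (hX : Simple X.out) : Simple ((g : Skeleton C) * X).out := by
  have key : ∀ a b : Skeleton C, a * b = 1 → Nonempty (a.out ⊗ b.out ≅ 𝟙_ C) := fun a b h =>
    Quotient.exact (h : toSkeleton (a.out ⊗ b.out) = toSkeleton (𝟙_ C))
  obtain ⟨e⟩ := key _ _ g.mul_inv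
  obtain ⟨e'⟩ := key _ _ g.inv_mul
  have := isEquivalence_tensorLeft e e'
  have hs : Simple ((g : Skeleton C).out ⊗ X.out) := simple_obj (tensorLeft _) X.out
  exact Simple.of_iso (fromSkeletonToSkeletonIso ((g : Skeleton C).out ⊗ X.out))

/-- The action of `G(C)` on `O(C)` by `g • X = g ⊗ X`. -/
instance [HasZeroMorphisms C] : MulAction (InvertibleClass C) (SimpleClass C) where
  smul g X := ⟨(g : Skeleton C) * X.1, simple_units_mul g X.1 X.2⟩
  one_smul X := Subtype.ext (one_mul X.1)
  mul_smul g h X := Subtype.ext (mul_assoc (g : Skeleton C) h X.1)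

/-- The subgroup `G[X]` of the `g` in `G(C)` such that `g ⊗ X ≅ X`. -/
def fixingSubgroup [HasZeroMorphisms C] (X : SimpleClass C) : Subgroup (InvertibleClass C) :=
  MulAction.stabilizer (InvertibleClass C) X

end Action

/-! ### Ribbon structures and traces -/

section Ribbon

variable (C : Type u) [Category.{v} C] [MonoidalCategory C] [BraidedCategory C] [RigidCategory C]

/-- A ribbon structure on a rigid braided category: a natural automorphism `θ` of the identity
functor with `θ_{X ⊗ Y} = (θ_X ⊗ θ_Y) ∘ σ_{Y,X} ∘ σ_{X,Y}` and `(θ_X)^* = θ_{X^*}`.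
Here `X^*` is `Xᘁ`, with `ev : X^* ⊗ X ⟶ 𝟙` and `coev : 𝟙 ⟶ X ⊗ X^*`. -/
class Ribbon where
  twist : 𝟭 C ≅ 𝟭 C
  twist_tensor : ∀ X Y : C, twist.hom.app (X ⊗ Y) =
    (β_ X Y).hom ≫ (β_ Y X).hom ≫ (twist.hom.app X ⊗ₘ twist.hom.app Y)
  twist_dual : ∀ X : C, (twist.hom.app X)ᘁ = twist.hom.app (Xᘁ)

variable {C}

/-- The Drinfeld morphism `u_X : X ⟶ X^{**}`, the composite
`X ⟶ X ⊗ (X^* ⊗ X^{**}) ⟶ (X^* ⊗ X) ⊗ X^{**} ⟶ X^{**}`. -/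
def drinfeld (X : C) : X ⟶ (Xᘁ)ᘁ :=
  (ρ_ X).inv ≫ X ◁ η_ (Xᘁ) ((Xᘁ)ᘁ) ≫ (α_ X (Xᘁ) ((Xᘁ)ᘁ)).inv ≫
    (β_ X (Xᘁ)).hom ▷ ((Xᘁ)ᘁ) ≫ ε_ X (Xᘁ) ▷ ((Xᘁ)ᘁ) ≫ (λ_ ((Xᘁ)ᘁ)).hom

/-- The pivotal structure `ψ_X = u_X ∘ θ_X : X ⟶ X^{**}` of a ribbon category (it is spherical). -/
def pivotal [Ribbon C] (X : C) : X ⟶ (Xᘁ)ᘁ :=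
  (Ribbon.twist (C := C)).hom.app X ≫ drinfeld X

/-- The trace of an endomorphism `f` of `X` with respect to the spherical structure, as an
endomorphism of the unit object: `𝟙 ⟶ X ⊗ X^* ⟶ X^{**} ⊗ X^* ⟶ 𝟙`. -/
def unitTrace [Ribbon C] {X : C} (f : X ⟶ X) : 𝟙_ C ⟶ 𝟙_ C :=
  η_ X (Xᘁ) ≫ (f ≫ pivotal X) ▷ (Xᘁ) ≫ ε_ (Xᘁ) ((Xᘁ)ᘁ)

end Ribbon

/-! ### The `S`-matrix and modularity -/

section SMatrix

variable (k : Type w) [Field k] {C : Type u} [Category.{v} C] [Abelian C] [Linear k C]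
  [MonoidalCategory C] [MonoidalPreadditive C] [MonoidalLinear k C] [RigidCategory C]
  [IsFusion k C]

/-- The identification of the endomorphism algebra of the unit object with `k`. -/
def unitScalar : End (𝟙_ C) ≃ₐ[k] k :=
  (AlgEquiv.ofBijective (Algebra.ofId k (End (𝟙_ C))) (IsFusion.end_unit (k := k) (C := C))).symm

variable [BraidedCategory C] [Ribbon C]

/-- The trace `Tr(f)` of an endomorphism of `X`, as an element of `k`. -/
def trace {X : C} (f : X ⟶ X) : k := unitScalar k (C := C) (unitTrace f)

variable (C) in
/-- The `S`-matrix `s_{X,Y} = Tr(σ_{Y,X} ∘ σ_{X,Y})`, indexed by the isomorphism classes of simple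
objects. -/
def sMatrix : Matrix (SimpleClass C) (SimpleClass C) k :=
  Matrix.of fun X Y => trace k ((β_ X.obj Y.obj).hom ≫ (β_ Y.obj X.obj).hom)

end SMatrix

/-- A modular tensor category over `k`: a pre-modular category over `k` (a braided fusion category
with a ribbon structure) whose `S`-matrix is non-degenerate. -/
class IsModular (k : Type w) [Field k] (C : Type u) [Category.{v} C] [Abelian C] [Linear k C]
    [MonoidalCategory C] [MonoidalPreadditive C] [MonoidalLinear k C] [RigidCategory C]
    [BraidedCategory C] [Ribbon C] : Prop extends IsFusion k C where
  nondegenerate : haveI := IsFusion.finite_simples (k := k) (C := C); (sMatrix k C).Nondegenerate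

end ModularTensor

end

open ModularTensor

open ModularTensor
noncomputable section

/-! For invertible g and simple Y, g ⊗ Y is simple, so by Schur's lemma the double braiding of g
with Y is a scalar. By the hexagon identities and multiplicativity of the trace, s_{g⊗X,Y} = c ·
s_{X,Y}, with c depending only on g and Y (`exists_sMatrix_smul_eq`). If g ⊗ X ≅ X and the row of X
has no zero, every such c is 1. Taking X to be the unit, g and 𝟙 have equal rows, so g = 𝟙 by
non-degeneracy (`eq_of_sMatrix_row_eq`). Most of the work is in the cyclicity and multiplicativity
of the trace. -/

namespace ModularTensor

/-! ### Ribbon traces computed with arbitrary duals -/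

section RibbonTrace

variable {C : Type u} [Category.{v} C] [MonoidalCategory C] [BraidedCategory C]

/-- Sliding the closed strand of `B` out of a strand `A` that it is doubly braided with. -/
theorem braiding_braiding_evaluation (A B B' : C) [ExactPairing B B'] :
    (β_ A B).hom ▷ B' ⊗≫ (β_ (B ⊗ A) B').hom ⊗≫ ε_ B B' ▷ A =
      𝟙 _ ⊗≫ A ◁ ((β_ B B').hom ≫ ε_ B B') ⊗≫ 𝟙 _ := by
  -- The strand `A` passes through the cap on `B ⊗ B'`, since braiding with the unit is trivial.
  have h := BraidedCategory.braiding_naturality_right A ((β_ B B').hom ≫ ε_ B B')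
  rw [BraidedCategory.braiding_tensor_right_hom, braiding_tensorUnit_right] at h
  calc
    (β_ A B).hom ▷ B' ⊗≫ (β_ (B ⊗ A) B').hom ⊗≫ ε_ B B' ▷ A =
        (α_ A B B').hom ≫ (((α_ A B B').inv ≫ (β_ A B).hom ▷ B' ≫ (α_ B A B').hom ≫
        B ◁ (β_ A B').hom ≫ (α_ B B' A).inv) ≫ ((β_ B B').hom ≫ ε_ B B') ▷ A) := by
      rw [BraidedCategory.braiding_tensor_left_hom]; monoidal
    _ = _ := by
      rw [← h]; monoidal

variable [RigidCategory C]

/-- A zigzag identity cancels the double dual, so the trace can be written with a single dual, which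
may then be chosen freely. -/
theorem drinfeld_whiskerRight_evaluation (X : C) :
    drinfeld X ▷ (Xᘁ) ≫ ε_ (Xᘁ) ((Xᘁ)ᘁ) = (β_ X (Xᘁ)).hom ≫ ε_ X (Xᘁ) :=
  calc
    _ = 𝟙 _ ⊗≫ X ◁ η_ (Xᘁ) ((Xᘁ)ᘁ) ▷ (Xᘁ) ⊗≫
        (((β_ X (Xᘁ)).hom ≫ ε_ X (Xᘁ)) ▷ ((Xᘁ)ᘁ ⊗ Xᘁ) ≫ 𝟙_ C ◁ ε_ (Xᘁ) ((Xᘁ)ᘁ)) ⊗≫ 𝟙 _ := by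
      dsimp only [drinfeld]; monoidal
    _ = 𝟙 _ ⊗≫ X ◁ (η_ (Xᘁ) ((Xᘁ)ᘁ) ▷ (Xᘁ) ⊗≫ (Xᘁ) ◁ ε_ (Xᘁ) ((Xᘁ)ᘁ)) ⊗≫
        ((β_ X (Xᘁ)).hom ≫ ε_ X (Xᘁ)) ⊗≫ 𝟙 _ := by
      rw [← whisker_exchange]; monoidal
    _ = _ := by rw [ExactPairing.evaluation_coevaluation'']; monoidal

variable [Ribbon C]

/-- The component `θ_X` of the twist, as an endomorphism of `X`. -/
def ribbonTwist (X : C) : X ⟶ X := (Ribbon.twist (C := C)).hom.app X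

theorem ribbonTwist_naturality {X Y : C} (f : X ⟶ Y) :
    f ≫ ribbonTwist Y = ribbonTwist X ≫ f :=
  (Ribbon.twist (C := C)).hom.naturality f

theorem ribbonTwist_tensor (X Y : C) : ribbonTwist (X ⊗ Y) =
    (β_ X Y).hom ≫ (β_ Y X).hom ≫ (ribbonTwist X ⊗ₘ ribbonTwist Y) :=
  Ribbon.twist_tensor X Y

theorem pivotal_eq (X : C) : pivotal X = ribbonTwist X ≫ drinfeld X := rfl

/-- The morphism `X ⊗ X' ⟶ 𝟙` that closes up the trace, for an arbitrary dual `X'` of `X`. -/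
def twistedCap (X X' : C) [ExactPairing X X'] : X ⊗ X' ⟶ 𝟙_ C :=
  ribbonTwist X ▷ X' ≫ (β_ X X').hom ≫ ε_ X X'

/-- The trace of an endomorphism of `X`, computed with an arbitrary dual `X'` of `X`. -/
def pairingTrace (X X' : C) [ExactPairing X X'] (f : X ⟶ X) : 𝟙_ C ⟶ 𝟙_ C :=
  η_ X X' ≫ f ▷ X' ≫ twistedCap X X'

theorem unitTrace_eq_pairingTrace {X : C} (f : X ⟶ X) :
    unitTrace f = pairingTrace X (Xᘁ) f := by
  simp only [unitTrace, pairingTrace, twistedCap, pivotal_eq, comp_whiskerRight, Category.assoc,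
    drinfeld_whiskerRight_evaluation]

/-- The trace is cyclic, and does not depend on the choice of the duals. -/
theorem pairingTrace_comp_comm (X X' Z Z' : C) [pX : ExactPairing X X'] [pZ : ExactPairing Z Z']
    (a : X ⟶ Z) (b : Z ⟶ X) : pairingTrace X X' (a ≫ b) = pairingTrace Z Z' (b ≫ a) := by
  -- `a'` is the transpose of `a` for the chosen duals; `a` travels around the loop through it.
  obtain ⟨a', h₁, h₂⟩ : ∃ a' : Z' ⟶ X', η_ Z Z' ≫ Z ◁ a' = η_ X X' ≫ a ▷ X' ∧
      a' ▷ X ≫ ε_ X X' = Z' ◁ a ≫ ε_ Z Z' := by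
    let _ : HasRightDual X := ⟨X'⟩
    let _ : HasRightDual Z := ⟨Z'⟩
    exact ⟨aᘁ, coevaluation_comp_rightAdjointMate a, rightAdjointMate_comp_evaluation a⟩
  simp only [pairingTrace, twistedCap, comp_whiskerRight, Category.assoc]
  rw [← Category.assoc (η_ X X') (a ▷ X'), ← h₁, Category.assoc, whisker_exchange_assoc,
    whisker_exchange_assoc,
    BraidedCategory.braiding_naturality_right_assoc, h₂,
    ← BraidedCategory.braiding_naturality_left_assoc,
    ← comp_whiskerRight_assoc a (ribbonTwist Z), ribbonTwist_naturality, comp_whiskerRight_assoc]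

/-- The twist of `A ⊗ B` supplies two extra braidings; each lets one of the two loops slide off the
other strand by `braiding_braiding_evaluation`, leaving nested caps. -/
theorem twistedCap_tensor (A A' B B' : C) [ExactPairing A A'] [ExactPairing B B'] :
    twistedCap (A ⊗ B) (B' ⊗ A') =
      𝟙 _ ⊗≫ A ◁ twistedCap B B' ▷ A' ⊗≫ twistedCap A A' := by
  have hβ : (β_ B A).hom ▷ B' ≫ (β_ (A ⊗ B) B').hom =
    (β_ (B ⊗ A) B').hom ≫ B' ◁ (β_ B A).hom := BraidedCategory.braiding_naturality_left _ _
  calc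
    _ = (ribbonTwist A ⊗ₘ ribbonTwist B) ▷ (B' ⊗ A') ≫ (α_ _ _ _).inv ≫
          ((β_ A B).hom ▷ B' ≫ ((β_ B A).hom ▷ B' ≫ (β_ (A ⊗ B) B').hom)) ▷ A' ⊗≫
          B' ◁ ((β_ (A ⊗ B) A').hom ⊗≫ ε_ A A' ▷ B) ⊗≫ ε_ B B' := by
      rw [twistedCap, ribbonTwist_tensor, ← BraidedCategory.braiding_naturality,
        ← BraidedCategory.braiding_naturality_assoc,
        BraidedCategory.braiding_tensor_right_hom (A ⊗ B) B' A', ExactPairing.tensor_evaluation]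
      monoidal
    _ = (ribbonTwist A ⊗ₘ ribbonTwist B) ▷ (B' ⊗ A') ⊗≫
          ((β_ A B).hom ▷ B' ≫ (β_ (B ⊗ A) B').hom) ▷ A' ⊗≫
          B' ◁ ((β_ B A).hom ▷ A' ⊗≫ (β_ (A ⊗ B) A').hom ⊗≫ ε_ A A' ▷ B) ⊗≫ ε_ B B' := by
      rw [hβ]; monoidal
    _ = (ribbonTwist A ⊗ₘ ribbonTwist B) ▷ (B' ⊗ A') ⊗≫
          ((β_ A B).hom ▷ B' ≫ (β_ (B ⊗ A) B').hom) ▷ A' ⊗≫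
          ((B' ⊗ B) ◁ ((β_ A A').hom ≫ ε_ A A') ≫ ε_ B B' ▷ 𝟙_ C) ⊗≫ 𝟙 _ := by
      rw [braiding_braiding_evaluation]; monoidal
    _ = (ribbonTwist A ⊗ₘ ribbonTwist B) ▷ (B' ⊗ A') ⊗≫
          ((β_ A B).hom ▷ B' ⊗≫ (β_ (B ⊗ A) B').hom ⊗≫ ε_ B B' ▷ A) ▷ A' ⊗≫
          ((β_ A A').hom ≫ ε_ A A') := by
      rw [whisker_exchange]; monoidal
    _ = ((ribbonTwist A ▷ B) ▷ (B' ⊗ A') ≫ (A ◁ ribbonTwist B) ▷ (B' ⊗ A')) ⊗≫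
          (A ◁ ((β_ B B').hom ≫ ε_ B B')) ▷ A' ⊗≫ ((β_ A A').hom ≫ ε_ A A') := by
      rw [braiding_braiding_evaluation, MonoidalCategory.tensorHom_def]; monoidal
    _ = 𝟙 _ ⊗≫ (ribbonTwist A ▷ (B ⊗ B') ≫
          A ◁ (ribbonTwist B ▷ B' ≫ (β_ B B').hom ≫ ε_ B B')) ▷ A' ⊗≫
          ((β_ A A').hom ≫ ε_ A A') := by
      monoidal
    _ = _ := by
      rw [← whisker_exchange]; dsimp only [twistedCap]; monoidal

/-- The trace of `A ◁ f` is obtained from that of `A` by inserting the trace of `f`. -/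
theorem pairingTrace_whiskerLeft (A A' B B' : C) [ExactPairing A A'] [ExactPairing B B']
    (f : B ⟶ B) : pairingTrace (A ⊗ B) (B' ⊗ A') (A ◁ f) =
      η_ A A' ⊗≫ A ◁ pairingTrace B B' f ▷ A' ⊗≫ twistedCap A A' := by
  rw [pairingTrace, twistedCap_tensor, ExactPairing.tensor_coevaluation, pairingTrace]
  monoidal

end RibbonTrace

attribute [local instance] Abelian.hasFiniteBiproducts

/-! ### Scalar traces in a fusion category -/

section FusionTrace

/-- The unit object of a fusion category is simple. -/
theorem simple_tensorUnit (k : Type w) [Field k] {C : Type u} [Category.{v} C] [Abelian C]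
    [Linear k C] [MonoidalCategory C] [MonoidalPreadditive C] [MonoidalLinear k C]
    [RigidCategory C] [IsFusion k C] : Simple (𝟙_ C) := by
  obtain ⟨n, F, hF, ⟨e⟩⟩ := IsFusion.semisimple (k := k) (𝟙_ C)
  have hbij := IsFusion.end_unit (k := k) (C := C)
  -- Each projection onto a summand is a scalar idempotent, hence 0 or 1. They sum to the identity,
  -- so one of them is 1 and its summand is the unit.
  have key : ∀ i, ∃ c : k, c • 𝟙 (𝟙_ C) = e.hom ≫ biproduct.π F i ≫ biproduct.ι F i ≫ e.inv :=
    fun i => hbij.2 (End.of (e.hom ≫ biproduct.π F i ≫ biproduct.ι F i ≫ e.inv))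
  have hne : 𝟙 (𝟙_ C) ≠ 0 := fun h => one_ne_zero (α := k) (hbij.1 (by
    rw [map_one, map_zero]; exact h))
  by_cases hn : ∃ i, e.hom ≫ biproduct.π F i ≫ biproduct.ι F i ≫ e.inv ≠ 0
  · obtain ⟨i, hi⟩ := hn
    obtain ⟨c, hc⟩ := key i
    have hc0 : c ≠ 0 := by rintro rfl; exact hi (by rw [← hc, zero_smul])
    have hcc : (c * c) • 𝟙 (𝟙_ C) = c • 𝟙 (𝟙_ C) := by
      calc
        _ = (c • 𝟙 (𝟙_ C)) ≫ (c • 𝟙 (𝟙_ C)) := by simp [mul_smul]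
        _ = _ := by rw [hc]; simp
    have hc1 : c = 1 := mul_left_cancel₀ hc0 (by rw [mul_one]; exact hbij.1 hcc)
    rw [hc1, one_smul] at hc
    have := hF i
    exact Simple.of_iso (Y := F i)
      ⟨e.hom ≫ biproduct.π F i, biproduct.ι F i ≫ e.inv, by simp [hc], by simp⟩
  · push Not at hn
    refine absurd ?_ hne
    have : 𝟙 (𝟙_ C) = e.hom ≫ (∑ i, biproduct.π F i ≫ biproduct.ι F i) ≫ e.inv := by
      rw [biproduct.total]; simp
    rw [this, Preadditive.sum_comp, Preadditive.comp_sum]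
    exact Finset.sum_eq_zero fun i _ => by rw [Category.assoc, hn i]

variable (k : Type w) [Field k] {C : Type u} [Category.{v} C] [Abelian C] [Linear k C]
  [MonoidalCategory C] [MonoidalPreadditive C] [MonoidalLinear k C] [RigidCategory C]
  [IsFusion k C] [BraidedCategory C] [Ribbon C]

theorem unitTrace_eq_trace_smul {X : C} (f : X ⟶ X) : unitTrace f = trace k f • 𝟙 (𝟙_ C) :=
  ((unitScalar k (C := C)).symm_apply_apply (unitTrace f)).symm

theorem trace_eq_of_unitTrace_eq_smul {X : C} {f : X ⟶ X} {c : k}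
    (h : unitTrace f = c • 𝟙 (𝟙_ C)) : trace k f = c :=
  (IsFusion.end_unit (k := k) (C := C)).1 ((unitTrace_eq_trace_smul k f).symm.trans h)

theorem trace_smul {X : C} (c : k) (f : X ⟶ X) : trace k (c • f) = c * trace k f := by
  apply trace_eq_of_unitTrace_eq_smul
  rw [mul_smul, ← unitTrace_eq_trace_smul, unitTrace, unitTrace]
  simp

theorem trace_comp_comm {X Z : C} (a : X ⟶ Z) (b : Z ⟶ X) :
    trace k (a ≫ b) = trace k (b ≫ a) := by
  rw [trace, trace, unitTrace_eq_pairingTrace, unitTrace_eq_pairingTrace,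
    pairingTrace_comp_comm X (Xᘁ) Z (Zᘁ)]

theorem trace_whiskerLeft (A : C) {B : C} (f : B ⟶ B) :
    trace k (A ◁ f) = trace k (𝟙 A) * trace k f := by
  apply trace_eq_of_unitTrace_eq_smul
  -- Cyclicity against the identity replaces the chosen dual of `A ⊗ B` by `Bᘁ ⊗ Aᘁ`.
  have h := pairingTrace_comp_comm (A ⊗ B) ((A ⊗ B)ᘁ) (A ⊗ B) (Bᘁ ⊗ Aᘁ) (A ◁ f) (𝟙 _)
  rw [Category.comp_id, Category.id_comp] at h
  rw [unitTrace_eq_pairingTrace, h, pairingTrace_whiskerLeft, ← unitTrace_eq_pairingTrace f,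
    unitTrace_eq_trace_smul k f, mul_comm, mul_smul, ← unitTrace_eq_trace_smul k (𝟙 A),
    unitTrace_eq_pairingTrace, pairingTrace]
  simp [monoidalComp]

end FusionTrace

/-! ### Double braiding with an invertible object -/

section SMatrix

variable (k : Type w) [Field k] {C : Type u} [Category.{v} C] [Abelian C] [Linear k C]
  [MonoidalCategory C] [MonoidalPreadditive C] [MonoidalLinear k C] [RigidCategory C]
  [IsFusion k C] [BraidedCategory C] [Ribbon C]

/-- The trace of the double braiding is invariant under isomorphisms of the first object. -/
theorem trace_braiding_congr {X X' : C} (e : X ≅ X') (Y : C) :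
    trace k ((β_ X Y).hom ≫ (β_ Y X).hom) = trace k ((β_ X' Y).hom ≫ (β_ Y X').hom) := by
  have h : (β_ X Y).hom ≫ (β_ Y X).hom =
      e.hom ▷ Y ≫ (β_ X' Y).hom ≫ (β_ Y X').hom ≫ e.inv ▷ Y := by
    simp [← BraidedCategory.braiding_naturality_right]
  rw [h, trace_comp_comm]
  simp

/-- By the hexagons, the double braiding of `A` with `Y` sits in the middle of that of `A ⊗ X` with
`Y`, so its scalar pulls out. -/
theorem trace_braiding_tensor {A X Y : C} {c : k}
    (h : (β_ A Y).hom ≫ (β_ Y A).hom = c • 𝟙 (A ⊗ Y)) :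
    trace k ((β_ (A ⊗ X) Y).hom ≫ (β_ Y (A ⊗ X)).hom) =
      c * trace k (𝟙 A) * trace k ((β_ X Y).hom ≫ (β_ Y X).hom) := by
  have h' : (β_ (A ⊗ X) Y).hom ≫ (β_ Y (A ⊗ X)).hom =
      (α_ A X Y).hom ≫ (c • A ◁ ((β_ X Y).hom ≫ (β_ Y X).hom)) ≫ (α_ A X Y).inv := by
    rw [BraidedCategory.braiding_tensor_left_hom, BraidedCategory.braiding_tensor_right_hom]
    simp only [Category.assoc, Iso.hom_inv_id_assoc, ← comp_whiskerRight_assoc, h]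
    simp
  rw [h', trace_comp_comm, Category.assoc, Iso.inv_hom_id, Category.comp_id, trace_smul,
    trace_whiskerLeft, mul_assoc]

variable [IsAlgClosed k]

/-- The row of `g ⊗ X` in the `S`-matrix is obtained from that of `X` by multiplying its entries by
factors that depend only on `g` and the column. -/
theorem exists_sMatrix_smul_eq (g : InvertibleClass C) (Y : SimpleClass C) :
    ∃ c : k, ∀ X : SimpleClass C, sMatrix k C (g • X) Y = c * sMatrix k C X Y := by
  have iso : ∀ X : SimpleClass C, Nonempty ((g • X).obj ≅ (g : Skeleton C).out ⊗ X.obj) :=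
    fun X => ⟨fromSkeletonToSkeletonIso ((g : Skeleton C).out ⊗ X.obj)⟩
  have : Simple ((g : Skeleton C).out ⊗ Y.obj) :=
    have : Simple (g • Y).obj := (g • Y).2
    Simple.of_iso (Y := (g • Y).obj) (iso Y).some.symm
  have := IsFusion.finite_hom (k := k) ((g : Skeleton C).out ⊗ Y.obj)
    ((g : Skeleton C).out ⊗ Y.obj)
  obtain ⟨c, hc⟩ := endomorphism_simple_eq_smul_id k
    ((β_ (g : Skeleton C).out Y.obj).hom ≫ (β_ Y.obj (g : Skeleton C).out).hom)
  exact ⟨_, fun X => (trace_braiding_congr k (iso X).some Y.obj).trans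
    (trace_braiding_tensor k hc.symm)⟩

end SMatrix

/-! ### Consequences of non-degeneracy -/

section Modular

variable (k : Type w) [Field k] {C : Type u} [Category.{v} C] [Abelian C] [Linear k C]
  [MonoidalCategory C] [MonoidalPreadditive C] [MonoidalLinear k C] [RigidCategory C]
  [BraidedCategory C] [Ribbon C] [IsModular k C]

/-- Distinct simple objects have distinct rows in a non-degenerate `S`-matrix. -/
theorem eq_of_sMatrix_row_eq {X X' : SimpleClass C}
    (h : ∀ Y, sMatrix k C X Y = sMatrix k C X' Y) : X = X' := by
  classical
  have := IsFusion.finite_simples (k := k) (C := C)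
  have := Fintype.ofFinite (SimpleClass C)
  have hS : (sMatrix k C).Nondegenerate := IsModular.nondegenerate
  have h0 := (Matrix.nondegenerate_iff_forall_vecMul_and_mulVec_eq_zero.1 hS).1
    (Pi.single X 1 - Pi.single X' 1) (by
      ext Y
      simp [Matrix.sub_vecMul, h Y])
  by_contra hne
  simpa [hne] using congrFun h0 X

/-- If `g ⊗ X ≅ X` and the row of `X` has no zero entries, then `g` is trivial. -/
theorem eq_one_of_smul_eq [IsAlgClosed k] {g : InvertibleClass C} {X : SimpleClass C} (hg : g • X = X)
    (hX : ∀ Y, sMatrix k C X Y ≠ 0) : g = 1 := by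
  have hunit : Simple (1 : Skeleton C).out :=
    have := simple_tensorUnit k (C := C)
    Simple.of_iso (fromSkeletonToSkeletonIso (𝟙_ C))
  let I : SimpleClass C := ⟨1, hunit⟩
  have hI : g • I = I := eq_of_sMatrix_row_eq k fun Y => by
    obtain ⟨c, hc⟩ := exists_sMatrix_smul_eq k g Y
    -- At the fixed object `X` the factor multiplies a nonzero entry by `c` without changing it.
    have h1 : c = 1 := mul_right_cancel₀ (hX Y) (by rw [one_mul, ← hc X, hg])
    rw [hc I, h1, one_mul]
  have h : (g : Skeleton C) * 1 = 1 := congrArg Subtype.val hI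
  exact Units.ext (by rwa [mul_one] at h)

end Modular

end ModularTensor

end

open ModularTensor
theorem mainTheorem10 (k : Type w) [Field k] [IsAlgClosed k] [CharZero k]
    (C : Type u) [Category.{v} C] [Abelian C] [Linear k C]
    [MonoidalCategory C] [MonoidalPreadditive C] [MonoidalLinear k C] [RigidCategory C]
    [BraidedCategory C] [Ribbon C] [IsModular k C] :
    (∀ X : SimpleClass C, fixingSubgroup X ≠ ⊥ → ∃ Y : SimpleClass C, sMatrix k C X Y = 0) ∧
    ((∀ X Y : SimpleClass C, sMatrix k C X Y ≠ 0) →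
      ∀ (g : InvertibleClass C) (X : SimpleClass C), g • X = X → g = 1) := by
  refine ⟨fun X hX => ?_, fun h g X hg => eq_one_of_smul_eq k hg (h X)⟩
  by_contra! h
  exact hX ((Subgroup.eq_bot_iff_forall _).2 fun g hg => eq_one_of_smul_eq k hg h)
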